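/- Let $0<r_e<r_a<r_s$, $\lambda,\mu\ge 0$, and put $\bar\varphi=\arccos(r_e/r_a)+\arccos(r_e/r_s)$; assume $\bar\varphi\le\pi/2$. Consider the Cox satellite model: the orbits are the circles $l(\theta_i,\phi_i)$ of radius $r_s$ around the origin in $\mathbb{R}^3$ with longitude $\theta_i$ and inclination $\phi_i$, where $\Xi=\sum_i\delta_{(\theta_i,\phi_i)}$ is a Poisson point process with density $\lambda\sin(\phi)/(2\pi)$ on $[0,\pi)\times[0,\pi)$; conditionally on the orbits, the satellite processes $\psi_i$ on the orbits $l(\theta_i,\phi_i)$ are independent Poisson point processes with intensity $\mu/(2\pi r_s)$ per unit length (so that $\mu$ is the mean number of satellites per orbit); and the satellite process is $\Psi=\sum_i\psi_i$. Let the typical gateway be at $(0,0,r_e)$ on the surface of the Earth, the ball of radius $r_e$ around the origin, and its aerial platform at $A=(0,0,r_a)$. The extended spherical cap $S$ is the part of the sphere of radius $r_s$ around the origin that is visible from $A$, that is, the set of points $x$ of this sphere such that the segment from $A$ to $x$ does not meet the open ball of radius $r_e$; equivalently, $S=\{x:\|x\|=r_s,\ \|x-A\|\le\sqrt{r_a^2+r_s^2-2r_sr_a\cos\bar\varphi}\}$.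 Then the connectivity probability of the typical gateway, namely the probability that there is at least one satellite in $S$, is $$\mathbb{P}(\Psi(S)\ge 1)=1-\exp\left(-\lambda\int_0^{\bar\varphi}\cos(\varphi)\left(1-e^{-\frac{\mu}{\pi}\arcsin\sqrt{1-\cos^2(\bar\varphi)\sec^2(\varphi)}}\right)d\varphi\right).$$ -/

import Mathlib

open MeasureTheory ProbabilityTheory
open scoped NNReal ENNReal

noncomputable section

/-! ### Poisson point processes -/

/-- A counting measure of an at most countable family of points (with multiplicities). -/
def IsPointMeasure {X : Type*} [MeasurableSpace X] (ν : Measure X) : Prop :=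
  ∃ (ι : Type) (_ : Countable ι) (x : ι → X), ν = Measure.sum fun i => Measure.dirac (x i)

/-- `N` is a Poisson point process with intensity measure `Λ` on the probability space `(Ω, P)`:
a random point measure whose number of points in a measurable set `B` has the Poisson
distribution with mean `Λ B` (almost surely infinite if `Λ B = ∞`) and whose numbers of points
in finitely many pairwise disjoint measurable sets are independent. -/
structure IsPoissonProcess {Ω X : Type*} [MeasurableSpace Ω] [MeasurableSpace X]
    (N : Ω → Measure X) (Λ : Measure X) (P : Measure Ω) : Prop where
  measurable : Measurable N
  isPointMeasure : ∀ᵐ ω ∂P, IsPointMeasure (N ω)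
  hasLaw_count : ∀ B : Set X, MeasurableSet B → Λ B ≠ ∞ →
    HasLaw (fun ω => N ω B)
      ((poissonMeasure (Λ B).toNNReal).map (fun n : ℕ => (n : ℝ≥0∞))) P
  count_eq_top : ∀ B : Set X, MeasurableSet B → Λ B = ∞ → ∀ᵐ ω ∂P, N ω B = ∞
  indep : ∀ (n : ℕ) (B : Fin n → Set X), (∀ i, MeasurableSet (B i)) →
    Pairwise (fun i j => Disjoint (B i) (B j)) → iIndepFun (fun i ω => N ω (B i)) P

/-! ### Orbits -/

/-- Euclidean space, with the centre of the Earth as origin. -/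
abbrev Space : Type := EuclideanSpace ℝ (Fin 3)

/-- The point with argument angle `ω` on the circular orbit of radius `rs` around the origin with
longitude `p.1` and inclination `p.2`; the argument angle is measured along the orbit from the
ascending node `rs (cos p.1, sin p.1, 0)`. -/
def orbitPoint (rs : ℝ) (p : ℝ × ℝ) (ω : ℝ) : Space :=
  !₂[rs * (Real.cos ω * Real.cos p.1 - Real.sin ω * Real.cos p.2 * Real.sin p.1),
     rs * (Real.cos ω * Real.sin p.1 + Real.sin ω * Real.cos p.2 * Real.cos p.1),
     rs * (Real.sin ω * Real.sin p.2)]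

/-- The arc length measure on the orbit `p` of radius `rs`. The orbit is parametrized injectively
by the argument angle in `[0, 2π)`, with constant speed `rs`. -/
def orbitLength (rs : ℝ) (p : ℝ × ℝ) : Measure Space :=
  ENNReal.ofReal rs •
    (volume.restrict (Set.Ico (0 : ℝ) (2 * Real.pi))).map (orbitPoint rs p)

/-- The measure with density `lam * sin φ / (2π)` on the rectangle `[0, π) × [0, π)` of
pairs (longitude `θ`, inclination `φ`). -/
def orbitIntensity (lam : ℝ) : Measure (ℝ × ℝ) :=
  (volume.restrict (Set.Ico 0 Real.pi ×ˢ Set.Ico 0 Real.pi)).withDensity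
    fun p => ENNReal.ofReal (lam * Real.sin p.2 / (2 * Real.pi))

/-! ### The Cox satellite model -/

/-- The orbit process `∑_{i < K} δ_(O i)`, for a random number `K` of random orbits `O i`. -/
def orbitProcess {Ω : Type*} (K : Ω → ℕ) (O : ℕ → Ω → ℝ × ℝ) (ω : Ω) : Measure (ℝ × ℝ) :=
  ∑ i ∈ Finset.range (K ω), Measure.dirac (O i ω)

/-- The satellite process `∑_{i < K} ψ i`, where `ψ i` is the satellite process on the
`i`-th orbit. -/
def satelliteProcess {Ω : Type*} (K : Ω → ℕ) (ψ : ℕ → Ω → Measure Space) (ω : Ω) :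
    Measure Space :=
  ∑ i ∈ Finset.range (K ω), ψ i ω

/-- The intensity measure of the satellite process on the `i`-th orbit, given that there are
`c.1` orbits `c.2 0, …, c.2 (c.1 - 1)`: `μ / (2π rs)` times arc length on the orbit `c.2 i`
(and zero if there is no `i`-th orbit). -/
def satelliteIntensity (rs μ : ℝ) (c : ℕ × (ℕ → ℝ × ℝ)) (i : ℕ) : Measure Space :=
  if i < c.1 then ENNReal.ofReal (μ / (2 * Real.pi * rs)) • orbitLength rs (c.2 i) else 0

/-- The Cox satellite model on the probability space `(Ω, P)`. There are `K` orbits `O i` (`i < K`)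
forming a Poisson process of density `lam * sin φ / (2π)`; conditionally on the orbits, the
satellite processes `ψ i` are independent, and `ψ i` is a Poisson process of intensity
`μ / (2π rs)` (per unit length) on the orbit `O i`. -/
structure IsCoxSatelliteModel {Ω : Type*} [MeasurableSpace Ω] (P : Measure Ω) (rs lam μ : ℝ)
    (K : Ω → ℕ) (O : ℕ → Ω → ℝ × ℝ) (ψ : ℕ → Ω → Measure Space) : Prop where
  measurable_number : Measurable K
  measurable_orbit : ∀ i, Measurable (O i)
  measurable_satellite : ∀ i, Measurable (ψ i)
  orbits : IsPoissonProcess (orbitProcess K O) (orbitIntensity lam) P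
  satellites : ∃ κ : Kernel (ℕ × (ℕ → ℝ × ℝ)) (ℕ → Measure Space), IsMarkovKernel κ ∧
    HasCondDistrib (fun ω i => ψ i ω) (fun ω => (K ω, fun i => O i ω)) κ P ∧
    ∀ᵐ c ∂(P.map fun ω => (K ω, fun i => O i ω)),
      iIndepFun (fun (i : ℕ) (s : ℕ → Measure Space) => s i) (κ c) ∧
      ∀ i, IsPoissonProcess (fun s : ℕ → Measure Space => s i) (satelliteIntensity rs μ c i) (κ c)

/-! ### The extended spherical cap -/

/-- The position of the typical aerial platform. -/
def platform (ra : ℝ) : Space := !₂[0, 0, ra]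

/-- The part of the sphere of radius `rs` (carrying the satellites) within distance `d` of `x`. -/
def sphericalCap (rs : ℝ) (x : Space) (d : ℝ) : Set Space :=
  {y | y ∈ Metric.sphere (0 : Space) rs ∧ dist y x ≤ d}

/-- The extended spherical cap: the part of the sphere of radius `rs` that is visible from the
aerial platform, the line of sight being obstructed by the Earth, a ball of radius `re`. -/
def extendedCap (re ra rs : ℝ) : Set Space :=
  {y | y ∈ Metric.sphere (0 : Space) rs ∧
    Disjoint (segment ℝ (platform ra) y) (Metric.ball (0 : Space) re)}

/-- The angle `φ̄`: the central angle between the axis through the aerial platform and the rim of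
the extended spherical cap. -/
def capAngle (re ra rs : ℝ) : ℝ := Real.arccos (re / ra) + Real.arccos (re / rs)

/-- The extended spherical cap is the cap of radius `√(ra² + rs² - 2 rs ra cos φ̄)` around the
aerial platform. -/
theorem extendedCap_eq_sphericalCap (re ra rs : ℝ) (hre : 0 < re) (hra : re < ra) (hrs : re < rs) :
    extendedCap re ra rs = sphericalCap rs (platform ra)
      (Real.sqrt (ra ^ 2 + rs ^ 2 - 2 * rs * ra * Real.cos (capAngle re ra rs))) := by
  have hra0 : 0 < ra := hre.trans hra
  have hrs0 : 0 < rs := hre.trans hrs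
  obtain ⟨a, ha0, ha⟩ : ∃ a : ℝ, 0 < a ∧ a ^ 2 = ra ^ 2 - re ^ 2 :=
    ⟨√(ra ^ 2 - re ^ 2), Real.sqrt_pos.2 (by nlinarith), Real.sq_sqrt (by nlinarith)⟩
  obtain ⟨b, hb0, hb⟩ : ∃ b : ℝ, 0 < b ∧ b ^ 2 = rs ^ 2 - re ^ 2 :=
    ⟨√(rs ^ 2 - re ^ 2), Real.sqrt_pos.2 (by nlinarith), Real.sq_sqrt (by nlinarith)⟩
  have hsin : ∀ r c : ℝ, 0 < r → 0 < c → c ^ 2 = r ^ 2 - re ^ 2 →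
      Real.sqrt (1 - (re / r) ^ 2) = c / r := by
    intro r c hr hc h
    rw [show 1 - (re / r) ^ 2 = (c / r) ^ 2 by field_simp; linarith]
    exact Real.sqrt_sq (by positivity)
  have hcos : rs * ra * Real.cos (capAngle re ra rs) = re ^ 2 - a * b := by
    rw [capAngle, Real.cos_add, Real.sin_arccos, Real.sin_arccos, hsin ra a hra0 ha0 ha,
      hsin rs b hrs0 hb0 hb, Real.cos_arccos, Real.cos_arccos]
    · field_simp
    · have : 0 < re / rs := by positivity
      linarith
    · exact (div_le_one hrs0).2 hrs.le
    · have : 0 < re / ra := by positivity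
      linarith
    · exact (div_le_one hra0).2 hra.le
  have hd : ra ^ 2 + rs ^ 2 - 2 * rs * ra * Real.cos (capAngle re ra rs) = (a + b) ^ 2 := by
    nlinarith
  rw [hd, Real.sqrt_sq (by positivity)]
  ext y
  simp only [extendedCap, sphericalCap, Set.mem_ofPred_eq, mem_sphere_zero_iff_norm]
  refine and_congr_right fun hy => ?_
  have hy2 : y 0 ^ 2 + y 1 ^ 2 + y 2 ^ 2 = rs ^ 2 := by
    rw [← hy, EuclideanSpace.real_norm_sq_eq, Fin.sum_univ_three]
  have hdist : dist y (platform ra) ^ 2 = ra ^ 2 + rs ^ 2 - 2 * ra * y 2 := by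
    rw [dist_eq_norm, EuclideanSpace.real_norm_sq_eq, Fin.sum_univ_three]
    simp [platform]
    nlinarith
  have hseg : ∀ t : ℝ, ‖(1 - t) • platform ra + t • y‖ ^ 2 =
      (1 - t) ^ 2 * ra ^ 2 + t ^ 2 * rs ^ 2 + 2 * t * (1 - t) * (ra * y 2) := by
    intro t
    rw [EuclideanSpace.real_norm_sq_eq, Fin.sum_univ_three]
    simp [platform]
    linear_combination t ^ 2 * hy2
  rw [← pow_le_pow_iff_left₀ dist_nonneg (by positivity) two_ne_zero, hdist, segment_eq_image,
    Set.disjoint_left]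
  simp only [Set.forall_mem_image, mem_ball_zero_iff, not_lt]
  constructor
  · intro h
    have hab : 0 < a + b := by positivity
    have h1 := h (x := a / (a + b)) ⟨by positivity, (div_le_one hab).2 (by linarith)⟩
    rw [← pow_le_pow_iff_left₀ hre.le (norm_nonneg _) two_ne_zero, hseg,
      show 1 - a / (a + b) = b / (a + b) by field_simp; ring] at h1
    field_simp at h1
    have h2 : a * b * (re ^ 2 - a * b) ≤ a * b * (ra * y 2) := by
      have e1 : ra ^ 2 = a ^ 2 + re ^ 2 := by linarith
      have e2 : rs ^ 2 = b ^ 2 + re ^ 2 := by linarith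
      rw [e1, e2] at h1
      nlinarith
    have h3 := le_of_mul_le_mul_left h2 (by positivity)
    nlinarith
  · rintro h t ⟨ht0, ht1⟩
    rw [← pow_le_pow_iff_left₀ hre.le (norm_nonneg _) two_ne_zero, hseg]
    have h3 : re ^ 2 - a * b ≤ ra * y 2 := by nlinarith
    have h4 := mul_le_mul_of_nonneg_left h3
      (show 0 ≤ 2 * t * (1 - t) by have := sub_nonneg.2 ht1; positivity)
    nlinarith [sq_nonneg ((1 - t) * a - t * b)]

end

/-! ### Poisson processes: avoidance probabilities and generating functional -/

/-! Given the orbits, the satellite counts in the cap `S` on the different orbits are independent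
Poisson variables, so `S` stays empty with conditional probability `∏ g (O i)`, where `g p = exp
(-mean count of orbit p in S)`. Averaging over the Poisson orbits by the generating functional `E ∏
g (O i) = exp (∫ (g - 1) dΛ)` gives the unconditional probability (`integral_prod_orbits`,
`IsCoxSatelliteModel.measureReal_count_lt_one`).

The mean count is geometric: on the sphere, `S` is the set of heights at least `rs cos φ̄`, while an
orbit of inclination `φ` has height `rs sin w sin φ`. It meets `S` where `sin w ≥ cos φ̄ / sin φ`,
an arc of angle `2 arcsin √(1 - cos² φ̄ / sin² φ)` (`orbitLength_extendedCap`; `φ̄ ≤ π/2` makes the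
threshold nonnegative). Passing to the complement of the inclination turns sines into cosines, and
orbits that stay below the cap contribute nothing, which truncates the integral at `φ̄`. -/

lemma integral_pow_poissonMeasure (r : ℝ≥0) (v : ℝ) :
    ∫ n, v ^ n ∂(poissonMeasure r) = Real.exp (r * (v - 1)) := by
  have h := NormedSpace.expSeries_div_hasSum_exp (𝔸 := ℝ) (r * v)
  rw [← Real.exp_eq_exp_ℝ] at h
  rw [integral_poissonMeasure, show (r : ℝ) * (v - 1) = -r + r * v by ring, Real.exp_add,
    ← (h.mul_left (Real.exp (-r))).tsum_eq]
  congr with n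
  rw [mul_pow, smul_eq_mul]
  ring

namespace IsPoissonProcess

variable {Ω X : Type*} [MeasurableSpace Ω] [MeasurableSpace X] {N : Ω → Measure X}
  {Λ : Measure X} {P : Measure Ω} {B : Set X}

lemma measurable_count (hN : IsPoissonProcess N Λ P) (hB : MeasurableSet B) :
    Measurable fun ω => N ω B :=
  (Measure.measurable_coe hB).comp hN.measurable

lemma measure_count_eq_zero (hN : IsPoissonProcess N Λ P) (hB : MeasurableSet B)
    (hΛ : Λ B ≠ ∞) : P {ω | N ω B = 0} = ENNReal.ofReal (Real.exp (-(Λ B).toReal)) := by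
  rw [(hN.hasLaw_count B hB hΛ).measure_eq (p := fun x => x = 0) (measurableSet_singleton 0),
    Set.ofPred_eq_eq_singleton, Measure.map_apply .of_discrete (measurableSet_singleton 0)]
  have : (fun n : ℕ => (n : ℝ≥0∞)) ⁻¹' {0} = {0} := by ext; simp
  rw [this, poissonMeasure_singleton]
  simp [ENNReal.toReal]

/-- Counts live in `ℝ≥0∞` but are almost surely integers, their law being an image of a law on `ℕ`.
This links the complement of `1 ≤ count` to the avoidance event. -/
lemma ae_count_eq_zero_of_lt_one (hN : IsPoissonProcess N Λ P) (hB : MeasurableSet B)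
    (hΛ : Λ B ≠ ∞) : ∀ᵐ ω ∂P, (N ω B < 1 → N ω B = 0) := by
  have hm : MeasurableSet {x : ℝ≥0∞ | x < 1 → x = 0} := by
    have : {x : ℝ≥0∞ | x < 1 → x = 0} = (Set.Iio 1)ᶜ ∪ {0} := by
      ext x; simp [imp_iff_not_or, or_comm]
    rw [this]
    exact measurableSet_Iio.compl.union (measurableSet_singleton 0)
  rw [(hN.hasLaw_count B hB hΛ).ae_iff (p := fun x => x < 1 → x = 0)
    (measurableSet_setOfPred.1 hm), ae_map_iff (by fun_prop) hm]
  exact .of_forall fun n h => by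
    have : n < 1 := by exact_mod_cast h
    simp [Nat.lt_one_iff.1 this]

lemma integral_pow_count (hN : IsPoissonProcess N Λ P) (hB : MeasurableSet B)
    (hΛ : Λ B ≠ ∞) (v : ℝ) :
    ∫ ω, v ^ ⌊(N ω B).toReal⌋₊ ∂P = Real.exp (Λ.real B * (v - 1)) := by
  have hm : Measurable fun x : ℝ≥0∞ => v ^ ⌊x.toReal⌋₊ :=
    (Measurable.of_discrete (f := fun n : ℕ => v ^ n)).comp
      (Nat.measurable_floor.comp ENNReal.measurable_toReal)
  have h := (hN.hasLaw_count B hB hΛ).integral_comp hm.aestronglyMeasurable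
  rw [integral_map (by fun_prop) hm.aestronglyMeasurable] at h
  simp only [Function.comp_def, ENNReal.toReal_natCast, Nat.floor_natCast] at h
  rw [h, integral_pow_poissonMeasure]
  rfl

/-- The generating functional of a Poisson process of finite intensity, at a simple function. -/
lemma integral_prod_pow_count_simpleFunc [IsProbabilityMeasure P] [IsFiniteMeasure Λ]
    (hN : IsPoissonProcess N Λ P)
    (g : SimpleFunc X ℝ) :
    ∫ ω, ∏ v ∈ g.range, v ^ ⌊(N ω (g ⁻¹' {v})).toReal⌋₊ ∂P = Real.exp (∫ x, (g x - 1) ∂Λ) := by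
  have hm (v : ℝ) : Measurable fun x : ℝ≥0∞ => v ^ ⌊x.toReal⌋₊ :=
    (Measurable.of_discrete (f := fun n : ℕ => v ^ n)).comp
      (Nat.measurable_floor.comp ENNReal.measurable_toReal)
  -- The fibres of `g` are disjoint, so their counts are independent; they are numbered by `Fin n`
  -- to fit `indep`.
  let e := g.range.equivFin
  have hind := hN.indep _ (fun i => g ⁻¹' {(e.symm i : ℝ)}) (fun i => g.measurableSet_fiber _)
    (fun i j hij => Disjoint.preimage _ (by
      simpa [Subtype.val_inj] using hij))
  have key := hind.integral_fun_prod_comp (f := fun i x => (e.symm i : ℝ) ^ ⌊x.toReal⌋₊)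
    (fun i => (hN.measurable_count (g.measurableSet_fiber _)).aemeasurable)
    (fun i => (hm _).aestronglyMeasurable)
  have reindex (F : ℝ → ℝ) : ∏ i, F (e.symm i) = ∏ v ∈ g.range, F v := by
    rw [← Finset.prod_coe_sort g.range F]
    exact e.symm.prod_comp fun v : g.range => F v
  rw [reindex fun v => ∫ ω, v ^ ⌊(N ω (g ⁻¹' {v})).toReal⌋₊ ∂P] at key
  simp_rw [fun ω => reindex fun v => v ^ ⌊(N ω (g ⁻¹' {v})).toReal⌋₊] at key
  rw [key, Finset.prod_congr rfl fun v _ => hN.integral_pow_count (g.measurableSet_fiber v)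
    (measure_ne_top _ _) v, ← Real.exp_sum]
  have hg : Integrable g Λ := SimpleFunc.integrable_of_isFiniteMeasure g
  have h1 := integral_sub hg (integrable_const (1 : ℝ))
  have h2 : ∑ v ∈ g.range, Λ.real (g ⁻¹' {v}) = Λ.real Set.univ := by
    rw [← measureReal_biUnion_finset]
    · congr 1
      ext x; simp
    · intro v _ w _ hvw
      exact Disjoint.preimage _ (by simpa using hvw)
    · exact fun v _ => g.measurableSet_fiber v
  rw [h1, ← SimpleFunc.integral_eq_integral _ hg, SimpleFunc.integral_eq]
  simp only [smul_eq_mul, integral_const, mul_one, mul_sub, Finset.sum_sub_distrib, h2]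

end IsPoissonProcess

section OrbitProcess

/-- Group the orbits by the value of `g`: the exponent of `v` is the number of orbits in the fibre
over `v`. -/
lemma prod_pow_orbitProcess {Ω : Type*} {K : Ω → ℕ} {O : ℕ → Ω → ℝ × ℝ}
    (g : SimpleFunc (ℝ × ℝ) ℝ) (ω : Ω) :
    ∏ v ∈ g.range, v ^ ⌊(orbitProcess K O ω (g ⁻¹' {v})).toReal⌋₊ =
      ∏ i ∈ Finset.range (K ω), g (O i ω) := by
  classical
  rw [← Finset.prod_fiberwise_of_maps_to (g := fun i => g (O i ω)) (t := g.range)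
    fun i _ => g.mem_range_self _]
  refine Finset.prod_congr rfl fun v _ => ?_
  have : orbitProcess K O ω (g ⁻¹' {v}) =
      (((Finset.range (K ω)).filter fun i => g (O i ω) = v).card : ℝ≥0∞) := by
    simp only [orbitProcess, Measure.coe_finsetSum, Finset.sum_apply,
      Measure.dirac_apply' _ (g.measurableSet_fiber v), Set.indicator_apply, Set.mem_preimage,
      Set.mem_singleton_iff, Pi.one_apply, Finset.sum_boole]
  rw [this, ENNReal.toReal_natCast, Nat.floor_natCast, ← Finset.prod_const]
  exact Finset.prod_congr rfl fun i hi => (Finset.mem_filter.1 hi).2.symm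

variable {Ω : Type*} [MeasurableSpace Ω] {K : Ω → ℕ} {O : ℕ → Ω → ℝ × ℝ}
  {Λ : Measure (ℝ × ℝ)} {P : Measure Ω}

lemma measurable_prod_range {f : ℕ → Ω → ℝ} (hK : Measurable K) (hf : ∀ i, Measurable (f i)) :
    Measurable fun ω => ∏ i ∈ Finset.range (K ω), f i ω := by
  have : Measurable fun p : Ω × ℕ => ∏ i ∈ Finset.range p.2, f i p.1 :=
    measurable_from_prod_countable_left fun n => by
      simpa using Finset.measurable_fun_prod _ fun i _ => hf i
  exact this.comp (measurable_id.prodMk hK)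

/-- The generating functional of a Poisson process of finite intensity. -/
lemma integral_prod_orbits [IsProbabilityMeasure P] [IsFiniteMeasure Λ]
    (hK : Measurable K) (hO : ∀ i, Measurable (O i))
    (hN : IsPoissonProcess (orbitProcess K O) Λ P)
    {g : ℝ × ℝ → ℝ} (hg : Measurable g) (hg1 : ∀ p, ‖g p‖ ≤ 1) :
    ∫ ω, ∏ i ∈ Finset.range (K ω), g (O i ω) ∂P = Real.exp (∫ p, (g p - 1) ∂Λ) := by
  -- Simple approximations that keep the bound 1 make every random product bounded by 1, so
  -- dominated convergence applies on both sides of the identity.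
  have hs := hg.stronglyMeasurable
  have hb := hs.norm_approxBounded_le zero_le_one
  have ht (p : ℝ × ℝ) := hs.tendsto_approxBounded_of_norm_le (hg1 p)
  have hl : Filter.Tendsto (fun n => ∫ ω, ∏ i ∈ Finset.range (K ω), hs.approxBounded 1 n (O i ω) ∂P)
      Filter.atTop (nhds (∫ ω, ∏ i ∈ Finset.range (K ω), g (O i ω) ∂P)) := by
    refine tendsto_integral_of_dominated_convergence (fun _ => 1)
      (fun n => (measurable_prod_range hK fun i =>
        (SimpleFunc.measurable _).comp (hO i)).aestronglyMeasurable) (integrable_const _)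
      (fun n => .of_forall fun ω => ?_) (.of_forall fun ω => tendsto_finsetProd _ fun i _ => ht _)
    rw [norm_prod]
    exact Finset.prod_le_one (fun _ _ => norm_nonneg _) fun i _ => hb n _
  have hr : Filter.Tendsto (fun n => ∫ p, (hs.approxBounded 1 n p - 1) ∂Λ)
      Filter.atTop (nhds (∫ p, (g p - 1) ∂Λ)) := by
    refine tendsto_integral_of_dominated_convergence (fun _ => 2)
      (fun n => ((SimpleFunc.measurable _).sub_const _).aestronglyMeasurable) (integrable_const _)
      (fun n => .of_forall fun p => ?_) (.of_forall fun p => (ht p).sub_const 1)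
    calc _ ≤ ‖hs.approxBounded 1 n p‖ + ‖(1 : ℝ)‖ := norm_sub_le _ _
      _ ≤ 2 := by rw [norm_one]; linarith [hb n p]
  refine tendsto_nhds_unique hl (((Real.continuous_exp.tendsto _).comp hr).congr fun n => ?_)
  rw [Function.comp_apply, ← hN.integral_prod_pow_count_simpleFunc]
  simp_rw [prod_pow_orbitProcess]

end OrbitProcess

/-! ### The arcs of orbits in a spherical cap -/

lemma continuous_orbitPoint (rs : ℝ) :
    Continuous fun q : (ℝ × ℝ) × ℝ => orbitPoint rs q.1 q.2 := by
  refine (PiLp.continuous_toLp 2 _).comp (continuous_pi fun i => ?_)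
  fin_cases i <;> simp <;> fun_prop

lemma continuous_orbitPoint_angle (rs : ℝ) (p : ℝ × ℝ) : Continuous (orbitPoint rs p) := by
  refine (PiLp.continuous_toLp 2 _).comp (continuous_pi fun i => ?_)
  fin_cases i <;> simp <;> fun_prop

lemma norm_orbitPoint {rs : ℝ} (hrs : 0 ≤ rs) (p : ℝ × ℝ) (w : ℝ) : ‖orbitPoint rs p w‖ = rs := by
  rw [← pow_left_inj₀ (norm_nonneg _) hrs two_ne_zero, EuclideanSpace.real_norm_sq_eq,
    Fin.sum_univ_three]
  simp only [orbitPoint, PiLp.toLp_apply, Matrix.cons_val_zero, Matrix.cons_val_one,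
    Matrix.cons_val]
  linear_combination rs ^ 2 * (Real.cos w ^ 2 + Real.sin w ^ 2 * Real.cos p.2 ^ 2) *
    Real.sin_sq_add_cos_sq p.1 + rs ^ 2 * Real.sin w ^ 2 * Real.sin_sq_add_cos_sq p.2 +
    rs ^ 2 * Real.sin_sq_add_cos_sq w

lemma measurableSet_extendedCap {re ra rs : ℝ} (hre : 0 < re) (hra : re < ra) (hrs : re < rs) :
    MeasurableSet (extendedCap re ra rs) := by
  rw [extendedCap_eq_sphericalCap re ra rs hre hra hrs]
  exact (Metric.isClosed_sphere.inter
    (isClosed_le (continuous_id.dist continuous_const) continuous_const)).measurableSet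

/-- On the sphere, the squared distance to the platform is an affine decreasing function of the
height `y 2`. -/
lemma mem_extendedCap_iff {re ra rs : ℝ} (hre : 0 < re) (hra : re < ra) (hrs : re < rs)
    {y : Space} (hy : ‖y‖ = rs) :
    y ∈ extendedCap re ra rs ↔ rs * Real.cos (capAngle re ra rs) ≤ y 2 := by
  have hra0 : 0 < ra := hre.trans hra
  have hy2 : y 0 ^ 2 + y 1 ^ 2 + y 2 ^ 2 = rs ^ 2 := by
    rw [← hy, EuclideanSpace.real_norm_sq_eq, Fin.sum_univ_three]
  have hdist : dist y (platform ra) ^ 2 = ra ^ 2 + rs ^ 2 - 2 * ra * y 2 := by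
    rw [dist_eq_norm, EuclideanSpace.real_norm_sq_eq, Fin.sum_univ_three]
    simp [platform]
    nlinarith
  rw [extendedCap_eq_sphericalCap re ra rs hre hra hrs]
  have hmem : y ∈ Metric.sphere (0 : Space) rs := mem_sphere_zero_iff_norm.2 hy
  simp only [sphericalCap, Set.mem_ofPred_eq, hmem, true_and]
  have hnonneg : 0 ≤ ra ^ 2 + rs ^ 2 - 2 * rs * ra * Real.cos (capAngle re ra rs) := by
    have := mul_nonneg (mul_nonneg (hre.trans hrs).le hra0.le)
      (sub_nonneg.2 (Real.cos_le_one (capAngle re ra rs)))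
    nlinarith [sq_nonneg (ra - rs)]
  rw [Real.le_sqrt dist_nonneg hnonneg, hdist]
  constructor
  · intro h
    refine le_of_mul_le_mul_left ?_ hra0
    linarith
  · intro h
    nlinarith [mul_le_mul_of_nonneg_left h hra0.le]

/-- For `c ≤ 1` the set is `[arcsin c, π - arcsin c]`, of length `2 arccos c`. For `c > 1` it is
empty, matching the value 0 of the square root at negative arguments. -/
lemma volume_sin_ge {c : ℝ} (hc : 0 ≤ c) :
    volume ({w | c ≤ Real.sin w} ∩ Set.Ico 0 (2 * Real.pi)) =
      ENNReal.ofReal (2 * Real.arcsin (Real.sqrt (1 - c ^ 2))) := by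
  have hpi := Real.pi_pos
  rcases lt_or_ge 1 c with h1 | h1
  · have : {w | c ≤ Real.sin w} = ∅ := by
      ext w
      simpa using (Real.sin_le_one w).trans_lt h1
    rw [this, Real.sqrt_eq_zero_of_nonpos (by nlinarith)]
    simp
  · have : {w | c ≤ Real.sin w} ∩ Set.Ico 0 (2 * Real.pi) =
        Set.Icc (Real.arcsin c) (Real.pi - Real.arcsin c) := by
      have ha0 := Real.arcsin_nonneg.2 hc
      have ha1 := Real.arcsin_le_pi_div_two c
      ext w
      simp only [Set.mem_inter_iff, Set.mem_ofPred_eq, Set.mem_Ico, Set.mem_Icc]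
      constructor
      · rintro ⟨hs, hw0, hw1⟩
        rcases le_total w (Real.pi / 2) with hw | hw
        · have := (Real.arcsin_le_iff_le_sin ⟨by linarith, h1⟩ ⟨by linarith, hw⟩).2 hs
          exact ⟨this, by linarith⟩
        · rcases le_total w (Real.pi + Real.pi / 2) with hw2 | hw2
          · rw [← Real.sin_pi_sub] at hs
            have := (Real.arcsin_le_iff_le_sin ⟨by linarith, h1⟩
              ⟨by linarith, by linarith⟩).2 hs
            exact ⟨by linarith, by linarith⟩
          · have := Real.sin_neg_of_neg_of_neg_pi_lt (x := w - 2 * Real.pi)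
              (by linarith) (by linarith)
            rw [Real.sin_sub_two_pi] at this
            linarith
      · rintro ⟨h2, h3⟩
        refine ⟨?_, by linarith, by linarith⟩
        rcases le_total w (Real.pi / 2) with hw | hw
        · exact (Real.arcsin_le_iff_le_sin ⟨by linarith, h1⟩ ⟨by linarith, hw⟩).1 h2
        · rw [← Real.sin_pi_sub]
          exact (Real.arcsin_le_iff_le_sin ⟨by linarith, h1⟩
            ⟨by linarith, by linarith⟩).1 (by linarith)
    rw [this, Real.volume_Icc, ← Real.arccos_eq_arcsin hc, Real.arccos]
    congr 1
    ring

/-- The length of the part of an orbit that lies in the extended spherical cap. -/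
lemma orbitLength_extendedCap {re ra rs : ℝ} (hre : 0 < re) (hra : re < ra) (hrs : re < rs)
    (hangle : capAngle re ra rs ≤ Real.pi / 2) {p : ℝ × ℝ} (hp : 0 < Real.sin p.2) :
    orbitLength rs p (extendedCap re ra rs) = ENNReal.ofReal rs * ENNReal.ofReal
      (2 * Real.arcsin (Real.sqrt
        (1 - Real.cos (capAngle re ra rs) ^ 2 * (1 / Real.sin p.2) ^ 2))) := by
  have hrs0 : 0 < rs := hre.trans hrs
  have hpi := Real.pi_pos
  have hcos : 0 ≤ Real.cos (capAngle re ra rs) := by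
    refine Real.cos_nonneg_of_neg_pi_div_two_le_of_le ?_ hangle
    have h1 := Real.arccos_nonneg (re / ra)
    have h2 := Real.arccos_nonneg (re / rs)
    rw [capAngle]
    linarith
  have hmeas : Measurable (orbitPoint rs p) := (continuous_orbitPoint_angle rs p).measurable
  have hS := measurableSet_extendedCap hre hra hrs
  have hpre : orbitPoint rs p ⁻¹' extendedCap re ra rs =
      {w | Real.cos (capAngle re ra rs) / Real.sin p.2 ≤ Real.sin w} := by
    ext w
    rw [Set.mem_preimage, mem_extendedCap_iff hre hra hrs (norm_orbitPoint hrs0.le p w),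
      Set.mem_ofPred_eq, div_le_iff₀ hp]
    simp only [orbitPoint, PiLp.toLp_apply, Matrix.cons_val]
    exact mul_le_mul_iff_right₀ hrs0
  rw [orbitLength, Measure.smul_apply, smul_eq_mul, Measure.map_apply hmeas hS,
    Measure.restrict_apply (hmeas hS), hpre, volume_sin_ge (div_nonneg hcos hp.le),
    div_eq_mul_one_div, mul_pow]

/-! ### Integration over the orbits -/

/-- Integrals over `[0, π)` of functions of the sine. -/
lemma intervalIntegral_comp_sin {h : ℝ → ℝ} (hh : Measurable h) {C : ℝ} (hC : ∀ x, |x| ≤ 1 → ‖h x‖ ≤ C) :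
    ∫ φ in (0 : ℝ)..Real.pi, h (Real.sin φ) =
      2 * ∫ φ in (0 : ℝ)..(Real.pi / 2), h (Real.cos φ) := by
  have hi (a b : ℝ) : IntervalIntegrable (fun φ => h (Real.sin φ)) volume a b :=
    (intervalIntegrable_const (c := C)).mono_fun
      (hh.comp Real.measurable_sin).aestronglyMeasurable
      (.of_forall fun φ => (hC _ (Real.abs_sin_le_one φ)).trans (le_abs_self C))
  rw [← intervalIntegral.integral_add_adjacent_intervals (hi 0 (Real.pi / 2)) (hi _ _)]
  -- `φ ↦ π/2 - φ` turns sine into cosine on the first half; `φ ↦ π - φ` folds the second half onto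
  -- the first.
  have h1 := intervalIntegral.integral_comp_sub_left (a := 0) (b := Real.pi / 2)
    (fun φ => h (Real.sin φ)) (Real.pi / 2)
  have h2 := intervalIntegral.integral_comp_sub_left (a := 0) (b := Real.pi / 2)
    (fun φ => h (Real.sin φ)) Real.pi
  simp only [Real.sin_pi_div_two_sub, Real.sin_pi_sub, sub_self, sub_zero] at h1 h2
  rw [h1, h2, sub_half, two_mul]

/-- The longitude contributes `π`, which against `1 / (2π)` leaves `1/2`; the folding of the
inclination contributes the compensating 2. -/
lemma integral_orbitIntensity {lam : ℝ} (hlam : 0 ≤ lam) {h : ℝ → ℝ} (hh : Measurable h) {C : ℝ}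
    (hC : ∀ x, ‖h x‖ ≤ C) :
    ∫ p, h (Real.sin p.2) ∂(orbitIntensity lam) =
      lam * ∫ φ in (0 : ℝ)..(Real.pi / 2), Real.cos φ * h (Real.cos φ) := by
  have hpi := Real.pi_pos
  rw [orbitIntensity, integral_withDensity_eq_integral_toReal_smul (by fun_prop)
    (.of_forall fun p => ENNReal.ofReal_lt_top)]
  have hset : MeasurableSet (Set.Ico 0 Real.pi ×ˢ Set.Ico 0 Real.pi) :=
    measurableSet_Ico.prod measurableSet_Ico
  have hcongr : ∫ p in Set.Ico 0 Real.pi ×ˢ Set.Ico 0 Real.pi,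
        (ENNReal.ofReal (lam * Real.sin p.2 / (2 * Real.pi))).toReal • h (Real.sin p.2) =
      ∫ p in Set.Ico 0 Real.pi ×ˢ Set.Ico 0 Real.pi,
        (lam / (2 * Real.pi)) * (Real.sin p.2 * h (Real.sin p.2)) := by
    refine setIntegral_congr_fun hset fun p hp => ?_
    have := Real.sin_nonneg_of_nonneg_of_le_pi hp.2.1 hp.2.2.le
    simp only [smul_eq_mul]
    rw [ENNReal.toReal_ofReal (by positivity)]
    ring
  rw [hcongr, integral_const_mul, Measure.volume_eq_prod]
  have := setIntegral_prod_mul (μ := volume) (ν := volume) (fun _ : ℝ => (1 : ℝ))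
    (fun φ => Real.sin φ * h (Real.sin φ)) (Set.Ico 0 Real.pi) (Set.Ico 0 Real.pi)
  have hbound (x : ℝ) (hx : |x| ≤ 1) : ‖x * h x‖ ≤ C := by
    rw [norm_mul, Real.norm_eq_abs x]
    exact (mul_le_of_le_one_left (norm_nonneg _) hx).trans (hC x)
  simp only [one_mul] at this
  rw [this, integral_Ico_eq_integral_Ioc (f := fun φ => Real.sin φ * h (Real.sin φ)),
    ← intervalIntegral.integral_of_le hpi.le,
    intervalIntegral_comp_sin (h := fun x => x * h x) (measurable_id.mul hh) (C := C) hbound]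
  simp [hpi.le]
  field_simp

instance isFiniteMeasure_orbitIntensity (lam : ℝ) : IsFiniteMeasure (orbitIntensity lam) := by
  have : IsFiniteMeasure ((volume : Measure (ℝ × ℝ)).restrict
      (Set.Ico 0 Real.pi ×ˢ Set.Ico 0 Real.pi)) := by
    refine ⟨?_⟩
    rw [Measure.restrict_apply_univ, Measure.volume_eq_prod, Measure.prod_prod, Real.volume_Ico]
    exact ENNReal.mul_lt_top ENNReal.ofReal_lt_top ENNReal.ofReal_lt_top
  refine isFiniteMeasure_withDensity_ofReal (HasFiniteIntegral.of_bounded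
    (C := |lam| / (2 * Real.pi)) (.of_forall fun p => ?_))
  have hpi := Real.pi_pos
  rw [norm_div, norm_mul, Real.norm_eq_abs, Real.norm_eq_abs, Real.norm_eq_abs,
    abs_of_pos (by positivity : 0 < 2 * Real.pi)]
  gcongr
  exact mul_le_of_le_one_right (abs_nonneg _) (Real.abs_sin_le_one _)

lemma ae_orbitIntensity_sin_pos (lam : ℝ) :
    ∀ᵐ p ∂(orbitIntensity lam), 0 < Real.sin p.2 := by
  refine (withDensity_absolutelyContinuous _ _).ae_le ?_
  have hset : MeasurableSet (Set.Ico 0 Real.pi ×ˢ Set.Ico 0 Real.pi) :=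
    measurableSet_Ico.prod measurableSet_Ico
  refine (ae_restrict_iff' hset).2 ?_
  have h0 : ∀ᵐ p : ℝ × ℝ, p.2 ≠ 0 := by
    rw [Measure.volume_eq_prod]
    exact Measure.quasiMeasurePreserving_snd.ae (Measure.ae_ne volume (0 : ℝ))
  filter_upwards [h0] with p hp hmem
  exact Real.sin_pos_of_pos_of_lt_pi (lt_of_le_of_ne hmem.2.1 (Ne.symm hp)) hmem.2.2

/-! ### The conditional avoidance probability -/

lemma measurable_orbitLength {S : Set Space} (hS : MeasurableSet S) (rs : ℝ) :
    Measurable fun p => orbitLength rs p S := by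
  have hmeas (p : ℝ × ℝ) := (continuous_orbitPoint_angle rs p).measurable
  have : (fun p => orbitLength rs p S) = fun p => ENNReal.ofReal rs *
      volume.restrict (Set.Ico (0 : ℝ) (2 * Real.pi))
        (Prod.mk p ⁻¹' ((fun q : (ℝ × ℝ) × ℝ => orbitPoint rs q.1 q.2) ⁻¹' S)) := by
    ext p
    rw [orbitLength, Measure.smul_apply, smul_eq_mul, Measure.map_apply (hmeas p) hS]
    rfl
  rw [this]
  exact (measurable_measure_prodMk_left ((continuous_orbitPoint rs).measurable hS)).const_mul _

lemma orbitLength_ne_top (rs : ℝ) (p : ℝ × ℝ) (S : Set Space) : orbitLength rs p S ≠ ∞ := by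
  rw [orbitLength, Measure.smul_apply, smul_eq_mul]
  exact ENNReal.mul_ne_top ENNReal.ofReal_ne_top (measure_ne_top _ _)

/-- Independent Poisson processes with finite means avoid a set jointly with the product of the
avoidance probabilities. -/
lemma measure_sum_count_lt_one {Ω X : Type*} [MeasurableSpace Ω] [MeasurableSpace X]
    {P : Measure Ω} {N : ℕ → Ω → Measure X} {Λ : ℕ → Measure X} {S : Set X}
    (hS : MeasurableSet S)
    (hind : iIndepFun N P) (hN : ∀ i, IsPoissonProcess (N i) (Λ i) P) (hΛ : ∀ i, Λ i S ≠ ∞)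
    (k : ℕ) :
    P {ω | ∑ i ∈ Finset.range k, N i ω S < 1} =
      ∏ i ∈ Finset.range k, ENNReal.ofReal (Real.exp (-(Λ i S).toReal)) := by
  -- A sum of counts is below 1 exactly when each count is, almost surely, zero; this exhibits the
  -- event as an intersection of independent ones.
  have hae : {ω | ∑ i ∈ Finset.range k, N i ω S < 1} =ᵐ[P]
      (⋂ i ∈ Finset.range k, N i ⁻¹' ((fun ν => ν S) ⁻¹' {0}) : Set Ω) := by
    filter_upwards [ae_all_iff.2 fun i => (hN i).ae_count_eq_zero_of_lt_one hS (hΛ i)] with ω hω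
    refine propext ⟨fun h => ?_, fun h => ?_⟩
    · refine Set.mem_iInter₂.2 fun i hi => hω i (lt_of_le_of_lt ?_ h)
      exact Finset.single_le_sum (f := fun i => N i ω S) (fun _ _ => zero_le) hi
    · have : ∑ i ∈ Finset.range k, N i ω S = 0 :=
        Finset.sum_eq_zero fun i hi => Set.mem_iInter₂.1 h i hi
      change ∑ i ∈ Finset.range k, N i ω S < 1
      rw [this]
      exact zero_lt_one
  rw [measure_congr hae, hind.measure_inter_preimage_eq_mul _ fun i _ =>
    Measure.measurable_coe hS (measurableSet_singleton 0)]
  exact Finset.prod_congr rfl fun i _ => (hN i).measure_count_eq_zero hS (hΛ i)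

/-- The probability that there are no satellites in a set. -/
lemma IsCoxSatelliteModel.measureReal_count_lt_one {Ω : Type*} [MeasurableSpace Ω] {P : Measure Ω}
    [IsProbabilityMeasure P] {rs lam μ : ℝ} {K : Ω → ℕ} {O : ℕ → Ω → ℝ × ℝ}
    {ψ : ℕ → Ω → Measure Space} (h : IsCoxSatelliteModel P rs lam μ K O ψ) {S : Set Space}
    (hS : MeasurableSet S) :
    P.real {ω | satelliteProcess K ψ ω S < 1} =
      Real.exp (∫ p, (Real.exp (-(ENNReal.ofReal (μ / (2 * Real.pi * rs)) *
        orbitLength rs p S).toReal) - 1) ∂(orbitIntensity lam)) := by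
  obtain ⟨κ, hκ, hcond, hae⟩ := h.satellites
  set g : ℝ × ℝ → ℝ := fun p => Real.exp (-(ENNReal.ofReal (μ / (2 * Real.pi * rs)) *
        orbitLength rs p S).toReal) with hg
  have hgm : Measurable g :=
    Real.measurable_exp.comp (((measurable_orbitLength hS rs).const_mul _).ennreal_toReal.neg)
  have hg1 (p : ℝ × ℝ) : ‖g p‖ ≤ 1 := by
    rw [Real.norm_eq_abs, Real.abs_exp, Real.exp_le_one_iff]
    simp only [Left.neg_nonpos_iff]
    positivity
  have hX : Measurable fun ω => (K ω, fun i => O i ω) :=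
    h.measurable_number.prodMk (measurable_pi_lambda _ h.measurable_orbit)
  have hsum : Measurable fun q : (ℕ × (ℕ → ℝ × ℝ)) × (ℕ → Measure Space) =>
      ∑ i ∈ Finset.range q.1.1, q.2 i S := by
    have : Measurable fun q : (ℕ → Measure Space) × ℕ => ∑ i ∈ Finset.range q.2, q.1 i S :=
      measurable_from_prod_countable_left fun n =>
        Finset.measurable_fun_sum (Finset.range n) fun i _ =>
        (Measure.measurable_coe hS).comp (measurable_pi_apply i)
    exact this.comp (measurable_snd.prodMk measurable_fst.fst)
  have hE : MeasurableSet {q : (ℕ × (ℕ → ℝ × ℝ)) × (ℕ → Measure Space) |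
      ∑ i ∈ Finset.range q.1.1, q.2 i S < 1} := measurableSet_lt hsum measurable_const
  -- Disintegration: the event depends only on the orbits and the satellite processes, whose joint
  -- law is the orbit law composed with `κ`.
  have hpair : P {ω | satelliteProcess K ψ ω S < 1} =
      (P.map (fun ω => (K ω, fun i => O i ω)) ⊗ₘ κ)
        {q | ∑ i ∈ Finset.range q.1.1, q.2 i S < 1} := by
    rw [← HasLaw.measure_eq hcond (p := fun q => ∑ i ∈ Finset.range q.1.1, q.2 i S < 1) hE]
    simp only [satelliteProcess, Measure.coe_finsetSum, Finset.sum_apply]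
  have hprod : Measurable fun ω => ∏ i ∈ Finset.range (K ω), g (O i ω) :=
    measurable_prod_range h.measurable_number fun i => hgm.comp (h.measurable_orbit i)
  have hprod' : Measurable fun c : ℕ × (ℕ → ℝ × ℝ) => ∏ i ∈ Finset.range c.1, g (c.2 i) :=
    measurable_prod_range measurable_fst fun i =>
      hgm.comp ((measurable_pi_apply i).comp measurable_snd)
  have hint : P {ω | satelliteProcess K ψ ω S < 1} =
      ∫⁻ ω, ENNReal.ofReal (∏ i ∈ Finset.range (K ω), g (O i ω)) ∂P := by
    rw [hpair, Measure.compProd_apply hE,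
      ← lintegral_map (f := fun c : ℕ × (ℕ → ℝ × ℝ) =>
        ENNReal.ofReal (∏ i ∈ Finset.range c.1, g (c.2 i))) hprod'.ennreal_ofReal hX]
    refine lintegral_congr_ae ?_
    filter_upwards [hae] with c hc
    have hfin (i : ℕ) : satelliteIntensity rs μ c i S ≠ ∞ := by
      rw [satelliteIntensity]
      split_ifs
      · exact ENNReal.mul_ne_top ENNReal.ofReal_ne_top (orbitLength_ne_top _ _ _)
      · simp
    have := measure_sum_count_lt_one hS hc.1 hc.2 hfin c.1
    refine this.trans ?_
    rw [ENNReal.ofReal_prod_of_nonneg fun _ _ => Real.exp_nonneg _]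
    refine Finset.prod_congr rfl fun i hi => ?_
    rw [satelliteIntensity, if_pos (Finset.mem_range.1 hi)]
    rfl
  have hnn (ω : Ω) : 0 ≤ ∏ i ∈ Finset.range (K ω), g (O i ω) :=
    Finset.prod_nonneg fun _ _ => Real.exp_nonneg _
  rw [Measure.real, hint, ← integral_eq_lintegral_of_nonneg_ae (.of_forall hnn)
    hprod.aestronglyMeasurable, integral_prod_orbits h.measurable_number h.measurable_orbit
    h.orbits hgm hg1]

lemma IsCoxSatelliteModel.measurable_count {Ω : Type*} [MeasurableSpace Ω] {P : Measure Ω}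
    {rs lam μ : ℝ} {K : Ω → ℕ} {O : ℕ → Ω → ℝ × ℝ}
    {ψ : ℕ → Ω → Measure Space} (h : IsCoxSatelliteModel P rs lam μ K O ψ) {S : Set Space}
    (hS : MeasurableSet S) : Measurable fun ω => satelliteProcess K ψ ω S := by
  have : Measurable fun q : Ω × ℕ => ∑ i ∈ Finset.range q.2, ψ i q.1 S :=
    measurable_from_prod_countable_left fun n =>
        Finset.measurable_fun_sum (Finset.range n) fun i _ =>
      (Measure.measurable_coe hS).comp (h.measurable_satellite i)
  simpa only [satelliteProcess, Measure.coe_finsetSum, Finset.sum_apply, Function.comp_def, id] using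
    this.comp (measurable_id.prodMk h.measurable_number)

/-! ### The connectivity probability -/

theorem theorem2 {Ω : Type*} [MeasurableSpace Ω] (P : Measure Ω) [IsProbabilityMeasure P]
    (re ra rs lam μ : ℝ) (hre : 0 < re) (hra : re < ra) (hrs : ra < rs)
    (hangle : capAngle re ra rs ≤ Real.pi / 2) (hlam : 0 ≤ lam) (hμ : 0 ≤ μ)
    (K : Ω → ℕ) (O : ℕ → Ω → ℝ × ℝ) (ψ : ℕ → Ω → Measure Space)
    (hmodel : IsCoxSatelliteModel P rs lam μ K O ψ) :
    P.real {ω | 1 ≤ satelliteProcess K ψ ω (extendedCap re ra rs)} =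
      1 - Real.exp (-lam * ∫ φ in (0 : ℝ)..capAngle re ra rs,
        Real.cos φ * (1 - Real.exp (-(μ / Real.pi) * Real.arcsin
          (Real.sqrt (1 - Real.cos (capAngle re ra rs) ^ 2 * (1 / Real.cos φ) ^ 2))))) := by
  have hpi := Real.pi_pos
  have hrs0 : 0 < rs := hre.trans (hra.trans hrs)
  have hS : MeasurableSet (extendedCap re ra rs) :=
    measurableSet_extendedCap hre hra (hra.trans hrs)
  have hangle0 : 0 ≤ capAngle re ra rs :=
    add_nonneg (Real.arccos_nonneg (re / ra)) (Real.arccos_nonneg (re / rs))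
  have hcompl : {ω | 1 ≤ satelliteProcess K ψ ω (extendedCap re ra rs)} =
      {ω | satelliteProcess K ψ ω (extendedCap re ra rs) < 1}ᶜ := by
    ext ω; simp
  rw [hcompl, probReal_compl_eq_one_sub (measurableSet_lt (hmodel.measurable_count hS)
    measurable_const), hmodel.measureReal_count_lt_one hS]
  set c := Real.cos (capAngle re ra rs) with hc
  set f : ℝ → ℝ := fun x => 1 - Real.exp (-(μ / Real.pi) * Real.arcsin
    (Real.sqrt (1 - c ^ 2 * (1 / x) ^ 2))) with hf
  have hfm : Measurable f := by fun_prop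
  have hf0 (x : ℝ) : 0 ≤ f x := by
    have h1 := Real.arcsin_nonneg.2 (Real.sqrt_nonneg (1 - c ^ 2 * (1 / x) ^ 2))
    rw [hf, sub_nonneg, Real.exp_le_one_iff, neg_mul, neg_nonpos]
    positivity
  have hf1 (x : ℝ) : f x ≤ 1 := sub_le_self _ (Real.exp_nonneg _)
  have hintensity : ∫ p, (Real.exp (-(ENNReal.ofReal (μ / (2 * Real.pi * rs)) *
      orbitLength rs p (extendedCap re ra rs)).toReal) - 1) ∂(orbitIntensity lam) =
      ∫ p, (fun x => -f x) (Real.sin p.2) ∂(orbitIntensity lam) := by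
    refine integral_congr_ae ?_
    filter_upwards [ae_orbitIntensity_sin_pos lam] with p hp
    have h1 := Real.arcsin_nonneg.2 (Real.sqrt_nonneg (1 - c ^ 2 * (1 / Real.sin p.2) ^ 2))
    rw [orbitLength_extendedCap hre hra (hra.trans hrs) hangle hp, ← hc,
      ENNReal.toReal_mul, ENNReal.toReal_mul, ENNReal.toReal_ofReal (by positivity),
      ENNReal.toReal_ofReal hrs0.le, ENNReal.toReal_ofReal (by positivity)]
    simp only [hf, neg_sub]
    congr 2
    field_simp
  rw [hintensity, integral_orbitIntensity hlam (h := fun x => -f x) hfm.neg (C := 1) fun x => by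
    rw [norm_neg, Real.norm_eq_abs, abs_of_nonneg (hf0 x)]; exact hf1 x]
  have hi (a b : ℝ) : IntervalIntegrable (fun φ => Real.cos φ * f (Real.cos φ)) volume a b := by
    refine (intervalIntegrable_const (c := (1 : ℝ))).mono_fun
      (Real.measurable_cos.mul (hfm.comp Real.measurable_cos)).aestronglyMeasurable
      (.of_forall fun φ => ?_)
    beta_reduce
    rw [norm_mul, norm_one, Real.norm_eq_abs, Real.norm_eq_abs, abs_of_nonneg (hf0 _)]
    exact mul_le_one₀ (Real.abs_cos_le_one φ) (hf0 _) (hf1 _)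
  -- Such orbits reach height at most `rs cos φ ≤ rs cos φ̄`: the radicand is nonpositive and the
  -- square root is 0.
  have hzero : ∫ φ in capAngle re ra rs..(Real.pi / 2), Real.cos φ * f (Real.cos φ) = 0 := by
    rw [intervalIntegral.integral_congr (g := fun _ => 0) fun φ hφ => ?_,
      intervalIntegral.integral_zero]
    rw [Set.uIcc_of_le hangle] at hφ
    have h1 : Real.cos φ ≤ c :=
      Real.cos_le_cos_of_nonneg_of_le_pi hangle0 (by linarith [hφ.2]) hφ.1
    have h0 : 0 ≤ Real.cos φ :=
      Real.cos_nonneg_of_neg_pi_div_two_le_of_le (by linarith [hφ.1]) hφ.2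
    rcases h0.eq_or_lt with h0 | h0
    -- At `cos φ = 0` the convention `1 / 0 = 0` means that `f` need not vanish; the factor `cos φ`
    -- does.
    · simp [← h0]
    · have h2 : 1 ≤ (c / Real.cos φ) ^ 2 := one_le_pow₀ ((one_le_div h0).2 h1)
      have h3 : Real.sqrt (1 - c ^ 2 * (1 / Real.cos φ) ^ 2) = 0 := by
        rw [← mul_pow, mul_one_div]
        exact Real.sqrt_eq_zero_of_nonpos (by linarith)
      simp only [hf, h3, Real.arcsin_zero, mul_zero, Real.exp_zero, sub_self]
  have hsplit := intervalIntegral.integral_add_adjacent_intervals (hi 0 (capAngle re ra rs))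
    (hi _ (Real.pi / 2))
  rw [hzero, add_zero] at hsplit
  simp only [mul_neg, intervalIntegral.integral_neg, ← hsplit, neg_mul]
  simp only [hf, neg_mul]
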